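/- Let $n\ge 1$, let $G$ be a group isomorphic to the dihedral group $D_n=\langle r,s\mid r^n=s^2=e,\ srs=r^{-1}\rangle$ of order $2n$, and let $H\le G$ be a subgroup. Let $\operatorname{Res}:H^3(G,\mathbb{Z})\to H^3(H,\mathbb{Z})$ be the restriction map on group cohomology, where $\mathbb{Z}$ carries the trivial action. (a) If $H$ contains a Klein four-subgroup of $G$ (a subgroup isomorphic to $\mathbb{Z}/2\mathbb{Z}\times\mathbb{Z}/2\mathbb{Z}$), then $\operatorname{Res}$ is an isomorphism; moreover $H^3(G,\mathbb{Z})$ and $H^3(H,\mathbb{Z})$ are both isomorphic to $\mathbb{Z}/2\mathbb{Z}$, and under these identifications $\operatorname{Res}$ is the identity map of $\mathbb{Z}/2\mathbb{Z}$. (b) If $H$ does not contain a Klein four-subgroup of $G$, then $\operatorname{Res}=0$. -/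

import Mathlib

open CategoryTheory

/-- The cohomology group `Hⁱ(G, ℤ)` of a group `G` with coefficients in the constant
(trivial) `G`-module `ℤ`. -/
noncomputable abbrev integralCohomology (G : Type) [Group G] (i : ℕ) : ModuleCat ℤ :=
  groupCohomology (Rep.trivial ℤ G ℤ) i

/-- The restriction map `Res : Hⁱ(G, ℤ) → Hⁱ(H, ℤ)` for a subgroup `H ≤ G`: it is induced by the
inclusion `H → G` and the identity of `ℤ`, that is, by restricting cochains `Gⁱ → ℤ` to `Hⁱ`. -/
noncomputable def integralRes {G : Type} [Group G] (H : Subgroup G) (i : ℕ) :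
    integralCohomology G i ⟶ integralCohomology H i :=
  groupCohomology.map (A := Rep.trivial ℤ G ℤ) (B := Rep.trivial ℤ H ℤ) H.subtype
    (𝟙 (Rep.trivial ℤ H ℤ)) i

/-- The subgroup `H` of `G` contains a Klein four-subgroup of `G`. -/
def ContainsKlein {G : Type} [Group G] (H : Subgroup G) : Prop :=
  ∃ K : Subgroup G, IsKleinFour K ∧ K ≤ H

/-!
For finite `G` the groups `Hⁱ(G, ℚ)`, `i > 0`, vanish by averaging, so the connecting homomorphism
of `0 → ℤ → ℚ → ℚ/ℤ → 0` identifies `H³(G, ℤ)` with `H²(G, ℚ/ℤ)`, compatibly with restriction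
(`integralRes_bockstein`). A class of the latter is a central extension of `G` by `ℚ/ℤ`, and it
is zero exactly when the extension splits.

Since `ℚ/ℤ` is divisible, an element `g` with `g ^ k = 1` lifts to an element `x` with `x ^ k = 1`.
Hence every extension of a finite cyclic group splits. For a dihedral group with rotation group
`⟨ρ⟩` of order `m` and a reflection `σ`, choose lifts `R`, `S` with `R ^ m = 1` and `S ^ 2 = 1`;
then `S R S⁻¹ = a R⁻¹` with `a` central and `a ^ m = 1`, and replacing `R` by `c R` multiplies `a`
by a square `c²`, where `c ^ m = 1`. If `m` is odd, `a` can be made trivial. If `m = 2k`, this is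
possible when `a ^ k = 1`, and `a ^ k` is the commutator of the lifts of `σ` and of the
rotation `ρ ^ k` of order two (`exists_section_of_isDihedralPair`).

So for `z` a rotation of order two and `σ` a reflection, the commutator of the lifts of `z` and `σ`,
which has order at most two, determines a class of `H³` (`bockstein_eq_zero_iff_commutatorPairing`);
an explicit cocycle shows that it is not always zero (`exists_commutatorPairing_ne_zero`). A Klein
four-subgroup `K ≤ H` contains such `z` and `σ`, and the commutator can be computed in `G` or in
`H`, so restriction is an isomorphism between groups of order two. If `H` contains no Klein
four-subgroup, then `H` is cyclic or is dihedral without a rotation of order two, and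
`H³(H, ℤ) = 0`.
-/

/-! ### Vanishing of the cohomology of a finite group with rational coefficients -/

section Averaging

variable {G : Type} [Group G] {n : ℕ}

lemma Fin.contractNth_castSucc_castSucc_snoc (j : Fin n) (g : Fin (n + 1) → G) (x : G) :
    Fin.contractNth j.castSucc.castSucc (· * ·) (Fin.snoc g x : Fin (n + 2) → G) =
      Fin.snoc (Fin.contractNth j.castSucc (· * ·) g) x := by
  funext k
  induction k using Fin.lastCases with
  | last =>
    rw [Fin.contractNth_apply_of_gt _ _ _ _ (by simp), Fin.snoc_last, Fin.succ_last, Fin.snoc_last]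
  | cast k =>
    rw [Fin.snoc_castSucc]
    simp only [Fin.contractNth, Fin.val_castSucc, Fin.succ_castSucc, Fin.snoc_castSucc]

lemma Fin.contractNth_last_eq_init (g : Fin (n + 1) → G) :
    Fin.contractNth (Fin.last n) (· * ·) g = Fin.init g := by
  funext k
  rw [Fin.contractNth_apply_of_lt _ _ _ _ (by simp)]
  rfl

lemma Fin.contractNth_castSucc_last_snoc (g : Fin (n + 1) → G) (x : G) :
    Fin.contractNth (Fin.last n).castSucc (· * ·) (Fin.snoc g x : Fin (n + 2) → G) =
      Fin.snoc (Fin.init g) (g (Fin.last n) * x) := by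
  funext k
  induction k using Fin.lastCases with
  | last =>
    rw [Fin.contractNth_apply_of_eq _ _ _ _ (by simp), Fin.snoc_last, Fin.succ_last, Fin.snoc_last,
      Fin.snoc_castSucc]
  | cast k =>
    rw [Fin.contractNth_apply_of_lt _ _ _ _ (by simp), Fin.snoc_castSucc, Fin.snoc_castSucc]
    rfl

omit [Group G] in
lemma Fin.snoc_comp_succ (g : Fin (n + 1) → G) (x : G) :
    (fun i : Fin (n + 1) => (Fin.snoc g x : Fin (n + 2) → G) i.succ) =
      Fin.snoc (fun i : Fin n => g i.succ) x := by
  funext k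
  induction k using Fin.lastCases with
  | last => simp
  | cast k => rw [Fin.snoc_castSucc, Fin.succ_castSucc, Fin.snoc_castSucc]

open inhomogeneousCochains in
/-- Summing the cocycle identity over the last variable exhibits `|G| • f` as the coboundary, up to
sign, of the sum of `f` over its last variable. -/
lemma d_sum_snoc [Fintype G] {V : Type} [AddCommGroup V] (f : (Fin (n + 1) → G) → V)
    (hf : d (Rep.trivial ℤ G V) (n + 1) f = 0) (g : Fin (n + 1) → G) :
    d (Rep.trivial ℤ G V) n (fun h => ∑ x, f (Fin.snoc h x)) g =
      (-1 : ℤ) ^ (n + 1) • (Fintype.card G : ℤ) • f g := by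
  have key (x : G) := congrFun hf (Fin.snoc g x)
  have hsum : ∑ x : G, d (Rep.trivial ℤ G V) (n + 1) f (Fin.snoc g x) = 0 :=
    Finset.sum_eq_zero fun x _ => key x
  have hlast : ∑ x, f (Fin.contractNth (Fin.last n).castSucc (· * ·)
      (Fin.snoc g x : Fin (n + 2) → G)) = ∑ x, f (Fin.snoc (Fin.init g) x) := by
    simp_rw [Fin.contractNth_castSucc_last_snoc]
    exact Fintype.sum_equiv (Equiv.mulLeft (g (Fin.last n))) _ _ fun x => rfl
  simp only [d_hom_apply, Representation.trivial_apply, Fin.snoc_comp_succ] at hsum ⊢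
  simp only [Finset.sum_add_distrib] at hsum
  rw [Finset.sum_comm, Fin.sum_univ_castSucc, Fin.sum_univ_castSucc] at hsum
  simp only [← Finset.smul_sum, Fin.contractNth_castSucc_castSucc_snoc, hlast,
    Fin.contractNth_last_eq_init, Fin.init_snoc, Finset.sum_const, Finset.card_univ] at hsum
  rw [Fin.sum_univ_castSucc]
  simp only [Fin.contractNth_last_eq_init, Fin.val_last, Fin.val_castSucc] at hsum ⊢
  rw [← sub_eq_zero, ← hsum, pow_succ _ (n + 1)]
  simp only [natCast_zsmul, mul_neg, mul_one, neg_smul, Finset.smul_sum]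
  abel

end Averaging

open groupCohomology in
/-- Averaging over the last variable is a contracting homotopy up to sign, so the cohomology of a
finite group with coefficients in `ℚ` vanishes in positive degrees. -/
lemma isZero_groupCohomology_rat (G : Type) [Group G] [Finite G] (n : ℕ) :
    Limits.IsZero (groupCohomology (Rep.trivial ℤ G ℚ) (n + 1)) := by
  have := Fintype.ofFinite G
  rw [ModuleCat.isZero_iff_subsingleton]
  refine subsingleton_of_forall_eq 0 fun x => ?_
  induction x using groupCohomology_induction_on with
  | h y =>
    set f : (Fin (n + 1) → G) → ℚ := iCocycles (Rep.trivial ℤ G ℚ) (n + 1) y with hf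
    have hdf : inhomogeneousCochains.d (Rep.trivial ℤ G ℚ) (n + 1) f = 0 := by
      have := (groupCohomology.inhomogeneousCochains (Rep.trivial ℤ G ℚ)).iCycles_d (n + 1) (n + 2)
      rw [inhomogeneousCochains.d_def] at this
      exact congr($this y)
    set c : ℚ := (-1) ^ (n + 1) / Fintype.card G with hc
    let F : (Fin n → G) → ℚ := fun h => c * ∑ x, f (Fin.snoc h x)
    have hF : inhomogeneousCochains.d (Rep.trivial ℤ G ℚ) n F = f := by
      funext g
      have h1 := d_sum_snoc f hdf g
      have h2 : inhomogeneousCochains.d (Rep.trivial ℤ G ℚ) n F g =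
          c * inhomogeneousCochains.d (Rep.trivial ℤ G ℚ) n
            (fun h => ∑ x, f (Fin.snoc h x)) g := by
        simp only [inhomogeneousCochains.d_hom_apply, Representation.trivial_apply, F, mul_add,
          Finset.mul_sum, mul_smul_comm]
      rw [h2, h1, hc]
      have : (Fintype.card G : ℚ) ≠ 0 := by simp
      change _ * ((-1 : ℤ) ^ (n + 1) • ((Fintype.card G : ℤ) • f g : ℚ)) = f g
      have hsq : ((-1 : ℚ) ^ (n + 1)) * (-1) ^ (n + 1) = 1 := by simp [← mul_pow]
      rw [zsmul_eq_mul, zsmul_eq_mul]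
      push_cast
      field_simp
      linear_combination f g * hsq
    have hy : y = toCocycles (Rep.trivial ℤ G ℚ) n (n + 1) F := by
      apply (ModuleCat.mono_iff_injective (iCocycles (Rep.trivial ℤ G ℚ) (n + 1))).1 inferInstance
      have := (groupCohomology.inhomogeneousCochains (Rep.trivial ℤ G ℚ)).toCycles_i n (n + 1)
      rw [inhomogeneousCochains.d_def] at this
      exact hf.symm.trans (hF.symm.trans congr($this F).symm)
    rw [hy]
    exact congr($((groupCohomology.inhomogeneousCochains
      (Rep.trivial ℤ G ℚ)).toCycles_comp_homologyπ n (n + 1)) F)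

/-! ### The connecting homomorphism `H²(G, ℚ/ℤ) → H³(G, ℤ)` -/

lemma Rep.exact_of_forall_exists {k G : Type} [CommRing k] [Group G]
    {S : ShortComplex (Rep.{0} k G)}
    (h : ∀ x : S.X₂, S.g.hom x = 0 → ∃ y : S.X₁, S.f.hom y = x) : S.Exact :=
  (forget₂ (Rep.{0} k G) (ModuleCat k)).reflects_exact_of_faithful _ <|
    (ShortComplex.moduleCat_exact_iff _).2 h

/-- The short exact sequence `0 → ℤ → ℚ → ℚ/ℤ → 0` of trivial representations. -/
noncomputable def intRatCircle (G : Type) [Group G] : ShortComplex (Rep ℤ G) where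
  X₁ := Rep.trivial ℤ G ℤ
  X₂ := Rep.trivial ℤ G ℚ
  X₃ := Rep.trivial ℤ G (AddCircle (1 : ℚ))
  f := Rep.ofHom ⟨(Int.castAddHom ℚ).toIntLinearMap, fun _ => rfl⟩
  g := Rep.ofHom
    ⟨(QuotientAddGroup.mk' (AddSubgroup.zmultiples (1 : ℚ))).toIntLinearMap, fun _ => rfl⟩
  zero := by
    refine Rep.hom_ext (Representation.IntertwiningMap.ext (LinearMap.ext fun x => ?_))
    change QuotientAddGroup.mk' (AddSubgroup.zmultiples (1 : ℚ)) ((x : ℤ) : ℚ) = 0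
    exact (QuotientAddGroup.eq_zero_iff _).2 (AddSubgroup.mem_zmultiples_iff.2 ⟨x, by simp⟩)

lemma intRatCircle_shortExact (G : Type) [Group G] : (intRatCircle G).ShortExact where
  exact := by
    refine Rep.exact_of_forall_exists fun x hx => ?_
    obtain ⟨m, hm⟩ := AddSubgroup.mem_zmultiples_iff.1 ((QuotientAddGroup.eq_zero_iff x).1 hx)
    exact ⟨m, (show ((m : ℤ) : ℚ) = x from (zsmul_one m).symm.trans hm)⟩
  mono_f := by
    rw [Rep.mono_iff_injective]
    exact Int.cast_injective (α := ℚ)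
  epi_g := by
    rw [Rep.epi_iff_surjective]
    exact QuotientAddGroup.mk_surjective

/-- Restriction from `G` to `H` as a morphism between the exact sequences of cochain complexes. -/
noncomputable def resShortComplex {G : Type} [Group G] (H : Subgroup G) :
    (intRatCircle G).map (groupCohomology.cochainsFunctor ℤ G) ⟶
      (intRatCircle H).map (groupCohomology.cochainsFunctor ℤ H) where
  τ₁ := groupCohomology.cochainsMap (A := Rep.trivial ℤ G ℤ) (B := Rep.trivial ℤ H ℤ) H.subtype
    (𝟙 (Rep.trivial ℤ H ℤ))
  τ₂ := groupCohomology.cochainsMap (A := Rep.trivial ℤ G ℚ) (B := Rep.trivial ℤ H ℚ) H.subtype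
    (𝟙 (Rep.trivial ℤ H ℚ))
  τ₃ := groupCohomology.cochainsMap (A := Rep.trivial ℤ G (AddCircle (1 : ℚ)))
    (B := Rep.trivial ℤ H (AddCircle (1 : ℚ))) H.subtype (𝟙 (Rep.trivial ℤ H (AddCircle (1 : ℚ))))
  comm₁₂ := by
    rfl
  comm₂₃ := by
    rfl

/-- `Z²(G, ℚ/ℤ)` for the trivial action. -/
abbrev circleCocycles (G : Type) [Group G] :=
  groupCohomology.cocycles₂ (Rep.trivial ℤ G (AddCircle (1 : ℚ)))

/-- The class in `H³(G, ℤ)` of a `ℚ/ℤ`-valued 2-cocycle, by the connecting homomorphism. -/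
noncomputable def bockstein (G : Type) [Group G] :
    circleCocycles G →ₗ[ℤ] integralCohomology G 3 :=
  (groupCohomology.H2π (Rep.trivial ℤ G (AddCircle (1 : ℚ))) ≫
    groupCohomology.δ (intRatCircle_shortExact G) 2 3 rfl).hom

lemma isIso_δ_intRatCircle (G : Type) [Group G] [Finite G] :
    IsIso (groupCohomology.δ (intRatCircle_shortExact G) 2 3 rfl) :=
  groupCohomology.isIso_δ_of_isZero _ 2 (isZero_groupCohomology_rat G 1)
    (isZero_groupCohomology_rat G 2)

lemma bockstein_surjective (G : Type) [Group G] [Finite G] :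
    Function.Surjective (bockstein G) := by
  have := isIso_δ_intRatCircle G
  have h1 := (ModuleCat.epi_iff_surjective
    (groupCohomology.δ (intRatCircle_shortExact G) 2 3 rfl)).1 inferInstance
  have h2 := (ModuleCat.epi_iff_surjective
    (groupCohomology.H2π (Rep.trivial ℤ G (AddCircle (1 : ℚ))))).1 inferInstance
  exact h1.comp h2

lemma bockstein_eq_zero_iff {G : Type} [Group G] [Finite G] (f : circleCocycles G) :
    bockstein G f = 0 ↔ ∃ x : G → AddCircle (1 : ℚ), ∀ g h, f (g, h) = x h - x (g * h) + x g := by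
  have := isIso_δ_intRatCircle G
  have hinj := (ModuleCat.mono_iff_injective
    (groupCohomology.δ (intRatCircle_shortExact G) 2 3 rfl)).1 inferInstance
  have h1 : bockstein G f = 0 ↔
      groupCohomology.H2π (Rep.trivial ℤ G (AddCircle (1 : ℚ))) f = 0 :=
    map_eq_zero_iff (groupCohomology.δ (intRatCircle_shortExact G) 2 3 rfl).hom hinj
  rw [h1, groupCohomology.H2π_eq_zero_iff]
  refine exists_congr fun x => ?_
  rw [eq_comm, funext_iff, Prod.forall]
  rfl

/-- Restriction of 2-cocycles to a subgroup. -/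
noncomputable def circleCocycles.res {G : Type} [Group G] (H : Subgroup G) (f : circleCocycles G) :
    circleCocycles H :=
  groupCohomology.mapCocycles₂ (A := Rep.trivial ℤ G (AddCircle (1 : ℚ)))
    (B := Rep.trivial ℤ H (AddCircle (1 : ℚ))) H.subtype (𝟙 _) f

lemma integralRes_bockstein {G : Type} [Group G] (H : Subgroup G) (f : circleCocycles G) :
    (integralRes H 3).hom (bockstein G f) = bockstein H (circleCocycles.res H f) := by
  have h1 := HomologicalComplex.HomologySequence.δ_naturality (resShortComplex H)
    (groupCohomology.map_cochainsFunctor_shortExact (intRatCircle_shortExact G))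
    (groupCohomology.map_cochainsFunctor_shortExact (intRatCircle_shortExact H)) 2 3 rfl
  have h2 := groupCohomology.H2π_comp_map (A := Rep.trivial ℤ G (AddCircle (1 : ℚ)))
    (B := Rep.trivial ℤ H (AddCircle (1 : ℚ))) H.subtype (𝟙 _)
  have h3 := congr($h1 (groupCohomology.H2π (Rep.trivial ℤ G (AddCircle (1 : ℚ))) f))
  have h4 := congr(groupCohomology.δ (intRatCircle_shortExact H) 2 3 rfl ($h2 f))
  exact h3.trans h4

/-! ### Splitting central extensions with divisible kernel -/

section Splitting

variable {E Γ : Type*} [Group E] [Group Γ]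

/-- `σ` is an involution outside the cyclic group `⟨ρ⟩`, inverting `ρ`, and `Γ = ⟨ρ⟩ ∪ ⟨ρ⟩σ`;
that is, `Γ` is dihedral with rotations `⟨ρ⟩` and a reflection `σ`. -/
structure IsDihedralPair (ρ σ : Γ) : Prop where
  sq : σ * σ = 1
  conj : σ * ρ * σ⁻¹ = ρ⁻¹
  notMem : σ ∉ Subgroup.zpowers ρ
  mem_or (g : Γ) : g ∈ Subgroup.zpowers ρ ∨ g * σ ∈ Subgroup.zpowers ρ

/-- Conjugation by the reflection inverts rotations, so it fixes those of order two. -/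
lemma IsDihedralPair.commute {ρ σ z : Γ} (h : IsDihedralPair ρ σ) (hz : z ∈ Subgroup.zpowers ρ)
    (hzz : z * z = 1) : Commute z σ := by
  have h1 : σ * z * σ⁻¹ = z⁻¹ := by
    obtain ⟨k, rfl⟩ := hz
    simp only [← conj_zpow, h.conj, inv_zpow]
  rw [inv_eq_of_mul_eq_one_left hzz] at h1
  exact (eq_mul_of_mul_inv_eq h1).symm

/-- `π` is a central extension: it is surjective with central kernel. Moreover its kernel is a
divisible group. -/
structure IsDivisibleCentralExtension (π : E →* Γ) : Prop where
  surjective : Function.Surjective π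
  commute (c x : E) : π c = 1 → Commute c x
  exists_root (c : E) (k : ℕ) : π c = 1 → 0 < k → ∃ d, π d = 1 ∧ d ^ k = c

/-- A cyclic group has at most one element of order two. -/
lemma eq_of_mem_zpowers_of_mul_self_eq_one {ρ x y : Γ} (hx : x ∈ Subgroup.zpowers ρ)
    (hy : y ∈ Subgroup.zpowers ρ) (hxx : x * x = 1) (hyy : y * y = 1) (hx1 : x ≠ 1) (hy1 : y ≠ 1) :
    x = y := by
  obtain ⟨i, rfl⟩ := hx
  obtain ⟨j, rfl⟩ := hy
  simp only [← zpow_add, ← orderOf_dvd_iff_zpow_eq_one, ne_eq] at *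
  rw [← orderOf_dvd_sub_iff_zpow_eq_zpow]
  obtain ⟨a, ha⟩ := hxx
  obtain ⟨b, hb⟩ := hyy
  obtain ⟨a, rfl | rfl⟩ := Int.even_or_odd' a
  · exact absurd ⟨a, by linarith⟩ hx1
  obtain ⟨b, rfl | rfl⟩ := Int.even_or_odd' b
  · exact absurd ⟨b, by linarith⟩ hy1
  exact ⟨a - b, by linarith⟩

lemma exists_section_of_subgroup (π : E →* Γ) (E' : Subgroup E) (hinj : ∀ x ∈ E', π x = 1 → x = 1)
    (hsurj : ∀ g, ∃ x ∈ E', π x = g) : ∃ s : Γ →* E, ∀ g, π (s g) = g := by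
  let e : E' ≃* Γ := MulEquiv.ofBijective (π.comp E'.subtype)
    ⟨(injective_iff_map_eq_one _).2 fun x hx => Subtype.ext (hinj x x.2 hx),
      fun g => (hsurj g).elim fun x hx => ⟨⟨x, hx.1⟩, hx.2⟩⟩
  exact ⟨E'.subtype.comp e.symm.toMonoidHom, e.apply_symm_apply⟩

namespace IsDivisibleCentralExtension

variable {π : E →* Γ}

lemma exists_lift_pow_eq_one (hπ : IsDivisibleCentralExtension π) {g : Γ} {k : ℕ} (hk : 0 < k)
    (hg : g ^ k = 1) : ∃ x, π x = g ∧ x ^ k = 1 := by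
  obtain ⟨x, rfl⟩ := hπ.surjective g
  obtain ⟨d, hd, hdk⟩ := hπ.exists_root (x ^ k)⁻¹ k (by simp [hg]) hk
  refine ⟨d * x, by simp [hd], ?_⟩
  rw [(hπ.commute d x hd).mul_pow, hdk, inv_mul_cancel]

lemma exists_section_of_isCyclic (hπ : IsDivisibleCentralExtension π) [Finite Γ] {ρ : Γ}
    (hρ : ∀ g, g ∈ Subgroup.zpowers ρ) : ∃ s : Γ →* E, ∀ g, π (s g) = g := by
  obtain ⟨R, hR, hRm⟩ := hπ.exists_lift_pow_eq_one (orderOf_pos ρ) (pow_orderOf_eq_one ρ)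
  refine exists_section_of_subgroup π (Subgroup.zpowers R) ?_ fun g => ?_
  · rintro _ ⟨j, rfl⟩ hj
    simp only [map_zpow, hR] at hj
    obtain ⟨l, rfl⟩ := orderOf_dvd_iff_zpow_eq_one.2 hj
    simp [zpow_mul, hRm]
  · obtain ⟨j, rfl⟩ := hρ g
    exact ⟨R ^ j, ⟨j, rfl⟩, by simp [hR]⟩

/-- Lifts of the generators satisfying the dihedral relations give a section. -/
lemma exists_section_of_lift {ρ σ : Γ} (h : IsDihedralPair ρ σ) {R S : E} (hR : π R = ρ)
    (hS : π S = σ) (hRm : R ^ orderOf ρ = 1) (hSS : S * S = 1) (hSR : S * R * S⁻¹ = R⁻¹) :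
    ∃ s : Γ →* E, ∀ g, π (s g) = g := by
  have hSinv : S⁻¹ = S := inv_eq_of_mul_eq_one_left hSS
  have hconj (x : E) (hx : x ∈ Subgroup.zpowers R) : S * x * S = x⁻¹ := by
    obtain ⟨j, rfl⟩ := hx
    calc S * R ^ j * S = S * R ^ j * S⁻¹ := by rw [hSinv]
      _ = (R ^ j)⁻¹ := by rw [← conj_zpow, hSR, inv_zpow]
  have hker (x : E) (hx : x ∈ Subgroup.zpowers R) (hx1 : π x = 1) : x = 1 := by
    obtain ⟨j, rfl⟩ := hx
    simp only [map_zpow, hR] at hx1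
    obtain ⟨l, rfl⟩ := orderOf_dvd_iff_zpow_eq_one.2 hx1
    simp [zpow_mul, hRm]
  have hmap (x : E) (hx : x ∈ Subgroup.zpowers R) : π x ∈ Subgroup.zpowers ρ := by
    obtain ⟨j, rfl⟩ := hx
    exact ⟨j, by simp [hR]⟩
  have hmul (x : E) (hx : x * S ∈ Subgroup.zpowers R) : ∃ u ∈ Subgroup.zpowers R, x = u * S :=
    ⟨x * S, hx, by rw [mul_assoc, hSS, mul_one]⟩
  let E' : Subgroup E :=
    { carrier := {x | x ∈ Subgroup.zpowers R ∨ x * S ∈ Subgroup.zpowers R}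
      one_mem' := Or.inl (one_mem _)
      mul_mem' := by
        rintro x y (hx | hx) (hy | hy)
        · exact Or.inl (mul_mem hx hy)
        · exact Or.inr (by rw [mul_assoc]; exact mul_mem hx hy)
        · obtain ⟨u, hu, rfl⟩ := hmul x hx
          exact Or.inr (by
            rw [show u * S * y * S = u * (S * y * S) by group, hconj y hy]
            exact mul_mem hu (inv_mem hy))
        · obtain ⟨u, hu, rfl⟩ := hmul x hx
          obtain ⟨v, hv, rfl⟩ := hmul y hy
          exact Or.inl (by
            rw [show u * S * (v * S) = u * (S * v * S) by group, hconj v hv]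
            exact mul_mem hu (inv_mem hv))
      inv_mem' := by
        rintro x (hx | hx)
        · exact Or.inl (inv_mem hx)
        · obtain ⟨u, hu, rfl⟩ := hmul x hx
          refine Or.inr ?_
          rw [mul_inv_rev, hSinv, hconj _ (inv_mem hu), inv_inv]
          exact hu }
  refine exists_section_of_subgroup π E' ?_ fun g => ?_
  · rintro x (hx | hx) hx1
    · exact hker x hx hx1
    · refine absurd (hmap _ hx) ?_
      rw [map_mul, hx1, one_mul, hS]
      exact h.notMem
  · obtain ⟨j, hj⟩ | ⟨j, hj⟩ := h.mem_or g
    · exact ⟨R ^ j, Or.inl ⟨j, rfl⟩, by simpa [hR] using hj⟩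
    · refine ⟨R ^ j * S, Or.inr ⟨j, by simp [mul_assoc, hSS]⟩, ?_⟩
      simp only at hj
      rw [map_mul, map_zpow, hR, hS, hj, mul_assoc, h.sq, mul_one]

/-- Any two lifts of an element differ by a central element, so whether the lifts of two elements
commute does not depend on the lifts. -/
lemma commute_of_commute (hπ : IsDivisibleCentralExtension π) {x y x' y' : E} (hx : π x = π x')
    (hy : π y = π y') (h : Commute x y) : Commute x' y' := by
  have h1 : π (x' * x⁻¹) = 1 := by simp [hx]
  have h2 : π (y' * y⁻¹) = 1 := by simp [hy]
  rw [← inv_mul_cancel_right x' x, ← inv_mul_cancel_right y' y]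
  exact (hπ.commute _ _ h1).mul_left ((hπ.commute _ _ h2).symm.mul_right h)

/-- A central extension of a dihedral group with divisible kernel splits as soon as the lifts of the
reflection `σ` commute with the lifts of the rotation of order two, if there is one. -/
lemma exists_section_of_isDihedralPair (hπ : IsDivisibleCentralExtension π) [Finite Γ] {ρ σ : Γ}
    (h : IsDihedralPair ρ σ)
    (hcomm : ∀ z ∈ Subgroup.zpowers ρ, z ≠ 1 → z * z = 1 →
      ∃ Z S : E, π Z = z ∧ π S = σ ∧ Commute Z S) :
    ∃ s : Γ →* E, ∀ g, π (s g) = g := by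
  set m := orderOf ρ with hm
  have hm0 : 0 < m := orderOf_pos ρ
  obtain ⟨R, hR, hRm⟩ := hπ.exists_lift_pow_eq_one hm0 (pow_orderOf_eq_one ρ)
  obtain ⟨S, hS, hSS⟩ := hπ.exists_lift_pow_eq_one two_pos (show σ ^ 2 = 1 by rw [sq, h.sq])
  rw [sq] at hSS
  -- `a` measures the failure of the relation `S R S⁻¹ = R⁻¹`; replacing `R` by `c R` multiplies it
  -- by `c²`.
  set a := S * R * S⁻¹ * R with ha
  have hSR : S * R * S⁻¹ = a * R⁻¹ := by rw [ha, mul_inv_cancel_right]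
  have ha1 : π a = 1 := by simp [ha, hR, hS, h.conj]
  have hpow (k : ℕ) : S * R ^ k * S⁻¹ = a ^ k * (R ^ k)⁻¹ := by
    rw [← conj_pow, hSR, (hπ.commute a R⁻¹ ha1).mul_pow, inv_pow]
  have ham : a ^ m = 1 := by simpa [hRm] using (hpow m).symm
  suffices hc : ∃ c, π c = 1 ∧ c ^ m = 1 ∧ c * c * a = 1 by
    obtain ⟨c, hc1, hcm, hca⟩ := hc
    refine exists_section_of_lift h (R := c * R) (S := S) (by simp [hc1, hR]) hS ?_ hSS ?_
    · rw [(hπ.commute c R hc1).mul_pow, hcm, ← hm, hRm, one_mul]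
    · have hcS := (hπ.commute c S hc1).eq
      have hca' : c * a = c⁻¹ := eq_inv_of_mul_eq_one_right (by rw [← mul_assoc, hca])
      calc S * (c * R) * S⁻¹ = c * (S * R * S⁻¹) := by
            rw [← mul_assoc S c R, ← hcS]; group
        _ = c⁻¹ * R⁻¹ := by rw [hSR, ← mul_assoc, hca']
        _ = (c * R)⁻¹ := by rw [(hπ.commute c R hc1).eq, mul_inv_rev]
  obtain ⟨k, hk | hk⟩ := Nat.even_or_odd' m
  · obtain ⟨Z, S', hZ, hS', hZS⟩ := hcomm (ρ ^ k) ⟨k, by simp⟩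
      (pow_ne_one_of_lt_orderOf (by lia) (by lia))
      (by rw [← pow_add, ← two_mul, ← hk, hm, pow_orderOf_eq_one])
    have hRS : Commute (R ^ k) S :=
      hπ.commute_of_commute (by rw [hZ, map_pow, hR]) (by rw [hS', hS]) hZS
    have hak : a ^ k = 1 := by
      have h1 := hpow k
      rw [← hRS.eq, mul_inv_cancel_right, eq_mul_inv_iff_mul_eq, ← pow_add, ← two_mul, ← hk,
        hRm] at h1
      exact h1.symm
    obtain ⟨c, hc, hca⟩ := hπ.exists_root a⁻¹ 2 (by simp [ha1]) two_pos
    refine ⟨c, hc, ?_, ?_⟩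
    · rw [hk, pow_mul, hca, inv_pow, hak, inv_one]
    · rw [← sq, hca, inv_mul_cancel]
  · refine ⟨a ^ k, by simp [ha1], by rw [← pow_mul, mul_comm, pow_mul, ham, one_pow], ?_⟩
    rw [← pow_add, ← pow_succ, ← two_mul, ← hk, ham]

end IsDivisibleCentralExtension

end Splitting

/-! ### The central extension defined by a 2-cocycle -/

section CocycleExtension

variable {Γ : Type} [Group Γ]

lemma circleCocycles_mul_assoc_eq (f : circleCocycles Γ) (g h j : Γ) :
    f (g * h, j) + f (g, h) = f (h, j) + f (g, h * j) :=
  (groupCohomology.mem_cocycles₂_iff _).1 f.2 g h j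

lemma circleCocycles_map_one_left (f : circleCocycles Γ) (g : Γ) : f (1, g) = f (1, 1) :=
  groupCohomology.cocycles₂_map_one_fst f g

lemma circleCocycles_map_one_right (f : circleCocycles Γ) (g : Γ) : f (g, 1) = f (1, 1) :=
  groupCohomology.cocycles₂_map_one_snd f g

/-- The central extension of `Γ` by `ℚ/ℤ` with underlying set `ℚ/ℤ × Γ` and multiplication twisted
by the 2-cocycle `f`. The cocycle is not assumed to be normalized, so the unit is `(-f(1,1), 1)`. -/
@[ext]
structure CocycleExtension (f : circleCocycles Γ) where
  fst : AddCircle (1 : ℚ)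
  snd : Γ

namespace CocycleExtension

variable {f : circleCocycles Γ}

instance : Mul (CocycleExtension f) :=
  ⟨fun x y => ⟨x.fst + y.fst + f (x.snd, y.snd), x.snd * y.snd⟩⟩

instance : One (CocycleExtension f) := ⟨⟨-f (1, 1), 1⟩⟩

instance : Inv (CocycleExtension f) :=
  ⟨fun x => ⟨-x.fst - f (x.snd⁻¹, x.snd) - f (1, 1), x.snd⁻¹⟩⟩

@[simp] lemma mul_fst (x y : CocycleExtension f) :
    (x * y).fst = x.fst + y.fst + f (x.snd, y.snd) := rfl

@[simp] lemma mul_snd (x y : CocycleExtension f) : (x * y).snd = x.snd * y.snd := rfl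

@[simp] lemma one_fst : (1 : CocycleExtension f).fst = -f (1, 1) := rfl

@[simp] lemma one_snd : (1 : CocycleExtension f).snd = 1 := rfl

instance : Group (CocycleExtension f) :=
  Group.ofLeftAxioms
    (fun x y z => by
      ext
      · simp only [mul_fst, mul_snd]
        have := circleCocycles_mul_assoc_eq f x.snd y.snd z.snd
        grind
      · exact mul_assoc _ _ _)
    (fun x => by
      ext
      · simp [circleCocycles_map_one_left f]
      · exact one_mul _)
    (fun x => by
      ext
      · change -x.fst - f (x.snd⁻¹, x.snd) - f (1, 1) + x.fst + f (x.snd⁻¹, x.snd) = -f (1, 1)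
        abel
      · exact inv_mul_cancel _)

variable (f) in
/-- The projection of the extension onto `Γ`. -/
def proj : CocycleExtension f →* Γ where
  toFun := snd
  map_one' := rfl
  map_mul' _ _ := rfl

@[simp] lemma proj_apply (x : CocycleExtension f) : proj f x = x.snd := rfl

lemma pow_fst (x : CocycleExtension f) (hx : x.snd = 1) (k : ℕ) :
    (x ^ k).fst = k • (x.fst + f (1, 1)) - f (1, 1) := by
  induction k with
  | zero => simp
  | succ k ih =>
    have : (x ^ k).snd = 1 := (map_pow (proj f) x k).trans (by simp [hx])
    rw [pow_succ, mul_fst, this, hx, ih, succ_nsmul]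
    abel

variable (f) in
lemma isDivisibleCentralExtension : IsDivisibleCentralExtension (proj f) where
  surjective g := ⟨⟨0, g⟩, rfl⟩
  commute c x hc := by
    rw [proj_apply] at hc
    ext
    · simp only [mul_fst, hc, circleCocycles_map_one_left f, circleCocycles_map_one_right f]
      abel
    · simp [hc]
  exists_root c k hc hk := by
    rw [proj_apply] at hc
    obtain ⟨b, hb⟩ : ∃ b : AddCircle (1 : ℚ), k • b = c.fst + f (1, 1) := by
      obtain ⟨q, hq⟩ := QuotientAddGroup.mk_surjective (c.fst + f (1, 1))
      refine ⟨((q / k : ℚ) : AddCircle (1 : ℚ)), ?_⟩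
      rw [← hq, ← AddCircle.coe_nsmul, nsmul_eq_mul, mul_div_cancel₀ _ (by positivity)]
    refine ⟨⟨b - f (1, 1), 1⟩, rfl, ?_⟩
    ext
    · rw [pow_fst _ rfl, sub_add_cancel, hb, add_sub_cancel_right]
    · exact (map_pow (proj f) _ k).trans (by simp [hc])

lemma bockstein_eq_zero_of_section [Finite Γ] (s : Γ →* CocycleExtension f)
    (hs : ∀ g, proj f (s g) = g) : bockstein Γ f = 0 := by
  refine (bockstein_eq_zero_iff f).2 ⟨fun g => -(s g).fst, fun g h => ?_⟩
  have h1 : (s (g * h)).fst = (s g).fst + (s h).fst + f (g, h) := by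
    have hg : (s g).snd = g := hs g
    have hh : (s h).snd = h := hs h
    rw [map_mul, mul_fst, hg, hh]
  simp only [h1]
  abel

end CocycleExtension

lemma integralCohomology_three_eq_zero_of_isCyclic [Finite Γ] {ρ : Γ}
    (hρ : ∀ g, g ∈ Subgroup.zpowers ρ) (x : integralCohomology Γ 3) : x = 0 := by
  obtain ⟨f, rfl⟩ := bockstein_surjective Γ x
  obtain ⟨s, hs⟩ :=
    (CocycleExtension.isDivisibleCentralExtension f).exists_section_of_isCyclic hρ
  exact CocycleExtension.bockstein_eq_zero_of_section s hs

/-- If the rotation group of a dihedral group has no element of order two, then `H³` vanishes. -/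
lemma integralCohomology_three_eq_zero_of_isDihedralPair [Finite Γ] {ρ σ : Γ}
    (h : IsDihedralPair ρ σ) (hodd : ∀ z ∈ Subgroup.zpowers ρ, z * z = 1 → z = 1)
    (x : integralCohomology Γ 3) : x = 0 := by
  obtain ⟨f, rfl⟩ := bockstein_surjective Γ x
  obtain ⟨s, hs⟩ :=
    (CocycleExtension.isDivisibleCentralExtension f).exists_section_of_isDihedralPair h
      fun z hz h1 h2 => absurd (hodd z hz h2) h1
  exact CocycleExtension.bockstein_eq_zero_of_section s hs

/-- The value at `(z, σ)` of the commutator pairing of the extension defined by a 2-cocycle. -/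
def commutatorPairing (z σ : Γ) (f : circleCocycles Γ) : AddCircle (1 : ℚ) :=
  f (z, σ) - f (σ, z)

lemma commutatorPairing_eq_zero_of_bockstein [Finite Γ] {z σ : Γ} (hc : Commute z σ)
    {f : circleCocycles Γ} (hf : bockstein Γ f = 0) : commutatorPairing z σ f = 0 := by
  obtain ⟨x, hx⟩ := (bockstein_eq_zero_iff f).1 hf
  rw [commutatorPairing, hx, hx, hc.eq]
  abel

lemma commutatorPairing_sub (z σ : Γ) (f f' : circleCocycles Γ) :
    commutatorPairing z σ (f - f') = commutatorPairing z σ f - commutatorPairing z σ f' := by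
  change f (z, σ) - f' (z, σ) - (f (σ, z) - f' (σ, z)) = _
  rw [commutatorPairing, commutatorPairing]
  abel

/-- Commutators of lifts are central, hence multiplicative in `z`, and `z² = 1`. -/
lemma two_nsmul_commutatorPairing {z σ : Γ} (hc : Commute z σ) (hz : z * z = 1)
    (f : circleCocycles Γ) : 2 • commutatorPairing z σ f = 0 := by
  have h1 := circleCocycles_mul_assoc_eq f z z σ
  have h2 := circleCocycles_mul_assoc_eq f z σ z
  have h3 := circleCocycles_mul_assoc_eq f σ z z
  rw [hz, circleCocycles_map_one_left f] at h1
  rw [hz, circleCocycles_map_one_right f] at h3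
  rw [← hc.eq] at h3
  rw [commutatorPairing]
  grind

/-- For a dihedral group with a rotation `z` of order two, the commutator pairing at `(z, σ)`
detects whether a class in `H³` vanishes. -/
lemma bockstein_eq_zero_iff_commutatorPairing [Finite Γ] {ρ σ z : Γ} (h : IsDihedralPair ρ σ)
    (hz : z ∈ Subgroup.zpowers ρ) (hzz : z * z = 1) (hz1 : z ≠ 1)
    (f : circleCocycles Γ) : bockstein Γ f = 0 ↔ commutatorPairing z σ f = 0 := by
  have hc : Commute z σ := h.commute hz hzz
  refine ⟨commutatorPairing_eq_zero_of_bockstein hc, fun hf => ?_⟩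
  obtain ⟨s, hs⟩ :=
    (CocycleExtension.isDivisibleCentralExtension f).exists_section_of_isDihedralPair h
      fun z' hz' h1 h2 => ⟨⟨0, z'⟩, ⟨0, σ⟩, rfl, rfl, by
        obtain rfl := eq_of_mem_zpowers_of_mul_self_eq_one hz' hz h2 hzz h1 hz1
        ext
        · simpa [commutatorPairing, sub_eq_zero] using hf
        · exact hc.eq⟩
  exact CocycleExtension.bockstein_eq_zero_of_section s hs

end CocycleExtension

/-! ### Rotations and reflections in subgroups of dihedral groups -/

section Dihedral

open DihedralGroup

variable {n : ℕ} {Γ : Type} [Group Γ]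

lemma DihedralGroup.mem_zpowers_r_one (x : DihedralGroup n) :
    x ∈ Subgroup.zpowers (r 1 : DihedralGroup n) ↔ ∃ i, x = r i := by
  constructor
  · rintro ⟨k, rfl⟩
    exact ⟨k, r_one_zpow k⟩
  · rintro ⟨i, rfl⟩
    exact ⟨i.cast, by simp only [r_one_zpow, ZMod.intCast_zmod_cast]⟩

/-- The rotations in a subgroup of a dihedral group form a cyclic group. -/
lemma exists_zpowers_eq_rotations {φ : Γ →* DihedralGroup n} (hφ : Function.Injective φ) :
    ∃ ρ : Γ, ∀ g, g ∈ Subgroup.zpowers ρ ↔ ∃ i, φ g = r i := by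
  let N := (Subgroup.zpowers (r 1 : DihedralGroup n)).comap φ
  have hN : IsCyclic N := isCyclic_of_injective (φ.subgroupComap (Subgroup.zpowers (r 1)))
    fun x y hxy => Subtype.ext (hφ (congrArg Subtype.val hxy))
  obtain ⟨ρ, hρ⟩ := hN.exists_generator
  refine ⟨ρ, fun g => ?_⟩
  rw [← mem_zpowers_r_one]
  constructor
  · rintro ⟨k, rfl⟩
    exact zpow_mem (K := N) ρ.2 k
  · intro hg
    obtain ⟨k, hk⟩ := hρ ⟨g, hg⟩
    exact ⟨k, congrArg Subtype.val hk⟩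

lemma isDihedralPair_of_reflection {φ : Γ →* DihedralGroup n} (hφ : Function.Injective φ) {ρ σ : Γ}
    (hρ : ∀ g, g ∈ Subgroup.zpowers ρ ↔ ∃ i, φ g = r i) {j : ZMod n} (hσ : φ σ = sr j) :
    IsDihedralPair ρ σ where
  sq := hφ (by simp [hσ])
  conj := by
    obtain ⟨i, hi⟩ := (hρ ρ).1 (Subgroup.mem_zpowers ρ)
    exact hφ (by simp [hσ, hi])
  notMem h := by
    obtain ⟨i, hi⟩ := (hρ σ).1 h
    simp [hσ] at hi
  mem_or g := by
    rcases hg : φ g with i | i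
    · exact Or.inl ((hρ g).2 ⟨i, hg⟩)
    · exact Or.inr ((hρ _).2 ⟨j - i, by simp [hg, hσ]⟩)

/-- A Klein four-subgroup of a dihedral group contains a rotation of order two and a reflection. -/
lemma exists_rotation_reflection_of_isKleinFour {φ : Γ →* DihedralGroup n}
    (hφ : Function.Injective φ) (K : Subgroup Γ) [IsKleinFour K] :
    ∃ z ∈ K, ∃ σ ∈ K, z ≠ 1 ∧ (∃ i, φ z = r i) ∧ ∃ j, φ σ = sr j := by
  obtain ⟨σ, j, hσ⟩ : ∃ σ : K, ∃ j, φ σ = sr j := by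
    by_contra! hK
    obtain ⟨ρ, hρ⟩ := exists_zpowers_eq_rotations (φ := φ.comp K.subtype)
      (hφ.comp K.subtype_injective)
    refine IsKleinFour.not_isCyclic (G := K) ⟨ρ, fun x => (hρ x).2 ?_⟩
    rcases hx : φ x with i | i
    · exact ⟨i, hx⟩
    · exact absurd hx (hK x i)
  have hσ1 : σ ≠ 1 := by
    rintro rfl
    rw [OneMemClass.coe_one, map_one, one_def] at hσ
    cases hσ
  obtain ⟨x, hx1, hxσ⟩ : ∃ x : K, x ≠ 1 ∧ x ≠ σ := by
    by_contra! hK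
    have h2 : Nat.card K = 2 := (Nat.card_eq_two_iff' 1).2 ⟨σ, hσ1, hK⟩
    have h4 : Nat.card K = 4 := IsKleinFour.card_four
    lia
  rcases hx : φ x with i | i
  · exact ⟨x, x.2, σ, σ.2, by simpa using hx1, ⟨i, hx⟩, j, hσ⟩
  · refine ⟨x * σ, mul_mem x.2 σ.2, σ, σ.2, fun h => hxσ ?_, ⟨j - i, by simp [hx, hσ]⟩, j, hσ⟩
    rw [← IsKleinFour.inv_eq_self σ]
    exact eq_inv_of_mul_eq_one_left (Subtype.ext h)

/-- Two distinct commuting involutions generate a Klein four-group. -/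
lemma exists_isKleinFour_le {H : Subgroup Γ} {z σ : Γ} (hz : z ∈ H) (hσ : σ ∈ H) (hz1 : z ≠ 1)
    (hσ1 : σ ≠ 1) (hzσ : z ≠ σ) (hzz : z * z = 1) (hσσ : σ * σ = 1) (hc : Commute z σ) :
    ContainsKlein H := by
  have hc' := hc.eq
  have hsq (a : Γ) (ha : a ∈ ({1, z, σ, z * σ} : Set Γ)) : a * a = 1 := by
    simp only [Set.mem_insert_iff, Set.mem_singleton_iff] at ha
    rcases ha with rfl | rfl | rfl | rfl <;> grind
  let K : Subgroup Γ :=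
    { carrier := {1, z, σ, z * σ}
      one_mem' := by simp
      mul_mem' := by
        simp only [Set.mem_insert_iff, Set.mem_singleton_iff]
        rintro a b (rfl | rfl | rfl | rfl) (rfl | rfl | rfl | rfl) <;> grind
      inv_mem' := fun {a} ha => by rwa [inv_eq_of_mul_eq_one_left (hsq a ha)] }
  have hne : z * σ ≠ 1 := fun h => hzσ (by
    rw [eq_inv_of_mul_eq_one_left h]; exact inv_eq_of_mul_eq_one_left hσσ)
  have : Nontrivial K := ⟨⟨z, by simp [K]⟩, 1, fun h => hz1 (congrArg Subtype.val h)⟩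
  refine ⟨K, ⟨?_, ?_⟩, ?_⟩
  · change Nat.card ({1, z, σ, z * σ} : Set Γ) = 4
    classical
    rw [Nat.card_coe_set_eq, Set.ncard_insert_of_notMem, Set.ncard_insert_of_notMem,
      Set.ncard_pair]
    · simpa using hz1
    · simp [hzσ, hσ1]
    · simp [hz1.symm, hσ1.symm, hne.symm]
  · rw [Monoid.exponent_eq_prime_iff Nat.prime_two]
    exact fun a ha => orderOf_eq_prime (by rw [sq]; exact Subtype.ext (hsq a a.2)) ha
  · rintro a (rfl | rfl | rfl | rfl)
    exacts [one_mem H, hz, hσ, mul_mem hz hσ]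

/-! ### A 2-cocycle with nontrivial commutator pairing -/

lemma ZMod.exists_injective_addCircle (n : ℕ) [NeZero n] :
    ∃ φ : ZMod n →+ AddCircle (1 : ℚ), Function.Injective φ := by
  have hn : (n : ℚ) ≠ 0 := NeZero.ne _
  have h (m : ℤ) : ((m : ℤ) • ((1 / n : ℚ) : AddCircle (1 : ℚ)) = 0) ↔ (m : ZMod n) = 0 := by
    rw [← AddCircle.coe_zsmul, AddCircle.coe_eq_zero_iff, ZMod.intCast_zmod_eq_zero_iff_dvd]
    refine exists_congr fun k => ?_
    simp only [zsmul_eq_mul]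
    field_simp
    rw [mul_comm]
    norm_cast
    exact eq_comm
  exact ⟨ZMod.lift n ⟨zmultiplesHom _ ((1 / n : ℚ) : AddCircle (1 : ℚ)), (h n).2 (by simp)⟩,
    (ZMod.lift_injective n).2 fun m hm => (h m).1 hm⟩

/-- The index `i` of the rotation `r i` or the reflection `sr i`. -/
def DihedralGroup.index : DihedralGroup n → ZMod n
  | r i => i
  | sr i => i

/-- The 2-cocycle of the dihedral group attached to `φ`: its value at `(r i, sr j)` and at
`(sr i, sr j)` is `φ i`, and it vanishes when the second argument is a rotation. -/
def DihedralGroup.reflectionCocycle (φ : ZMod n →+ AddCircle (1 : ℚ)) :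
    DihedralGroup n × DihedralGroup n → AddCircle (1 : ℚ)
  | (_, r _) => 0
  | (x, sr _) => φ x.index

lemma exists_commutatorPairing_ne_zero [NeZero n] (e : Γ →* DihedralGroup n) {z σ : Γ}
    {i j : ZMod n} (hz : e z = r i) (hi : i ≠ 0) (hσ : e σ = sr j) :
    ∃ f : circleCocycles Γ, commutatorPairing z σ f ≠ 0 := by
  obtain ⟨φ, hφ⟩ := ZMod.exists_injective_addCircle n
  refine ⟨⟨fun x => reflectionCocycle φ (e x.1, e x.2), ?_⟩, ?_⟩
  · refine (groupCohomology.mem_cocycles₂_iff _).2 fun g h k => ?_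
    change reflectionCocycle φ (e (g * h), e k) + reflectionCocycle φ (e g, e h) =
      reflectionCocycle φ (e h, e k) + reflectionCocycle φ (e g, e (h * k))
    rw [map_mul, map_mul]
    rcases e g with a | a <;> rcases e h with b | b <;> rcases e k with c | c <;>
      simp [reflectionCocycle, index, add_comm]
  · change reflectionCocycle φ (e z, e σ) - reflectionCocycle φ (e σ, e z) ≠ 0
    rw [hz, hσ]
    simpa [reflectionCocycle, index] using (map_ne_zero_iff φ hφ).2 hi

lemma AddCircle.eq_of_two_nsmul_eq_zero {u v : AddCircle (1 : ℚ)} (hu : 2 • u = 0)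
    (hv : 2 • v = 0) (hu0 : u ≠ 0) (hv0 : v ≠ 0) : u = v := by
  obtain ⟨p, rfl⟩ := QuotientAddGroup.mk_surjective u
  obtain ⟨q, rfl⟩ := QuotientAddGroup.mk_surjective v
  rw [← AddCircle.coe_nsmul, AddCircle.coe_eq_zero_iff] at hu hv
  rw [ne_eq, AddCircle.coe_eq_zero_iff] at hu0 hv0
  rw [← sub_eq_zero, ← AddCircle.coe_sub, AddCircle.coe_eq_zero_iff]
  simp only [zsmul_eq_mul, mul_one, nsmul_eq_mul, Nat.cast_ofNat] at *
  obtain ⟨a, ha⟩ := hu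
  obtain ⟨b, hb⟩ := hv
  obtain ⟨a, rfl | rfl⟩ := Int.even_or_odd' a
  · exact absurd ⟨a, by push_cast at ha; linarith⟩ hu0
  obtain ⟨b, rfl | rfl⟩ := Int.even_or_odd' b
  · exact absurd ⟨b, by push_cast at hb; linarith⟩ hv0
  exact ⟨a - b, by push_cast at *; linarith⟩

end Dihedral

/-! ### The restriction map -/

theorem proposition4 (n : ℕ) (hn : 0 < n) (G : Type) [Group G]
    (hG : Nonempty (G ≃* DihedralGroup n)) (H : Subgroup G) :
    (ContainsKlein H →
      Function.Bijective (integralRes H 3).hom ∧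
      ∃ (eG : integralCohomology G 3 ≃+ ZMod 2) (eH : integralCohomology H 3 ≃+ ZMod 2),
        ∀ x : integralCohomology G 3, eH ((integralRes H 3).hom x) = eG x) ∧
    (¬ ContainsKlein H → integralRes H 3 = 0) := by
  have : NeZero n := ⟨hn.ne'⟩
  obtain ⟨e⟩ := hG
  have : Finite G := Finite.of_equiv _ e.symm.toEquiv
  have heG : Function.Injective e.toMonoidHom := e.injective
  have heH : Function.Injective (e.toMonoidHom.comp H.subtype) :=
    e.injective.comp H.subtype_injective
  obtain ⟨ρH, hρH⟩ := exists_zpowers_eq_rotations heH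
  refine ⟨?_, fun hK => ?_⟩
  · rintro ⟨K, hK, hKH⟩
    obtain ⟨ρG, hρG⟩ := exists_zpowers_eq_rotations heG
    obtain ⟨z, hzK, σ, hσK, hz1, ⟨i, hi⟩, j, hj⟩ := exists_rotation_reflection_of_isKleinFour heG K
    have hzz : z * z = 1 := congrArg Subtype.val (IsKleinFour.mul_self (⟨z, hzK⟩ : K))
    let z' : H := ⟨z, hKH hzK⟩
    let σ' : H := ⟨σ, hKH hσK⟩
    have hzG {f} := bockstein_eq_zero_iff_commutatorPairing
      (isDihedralPair_of_reflection heG hρG hj) ((hρG z).2 ⟨i, hi⟩) hzz hz1 f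
    have hzz' : z' * z' = 1 := Subtype.ext hzz
    have hz'ρ : z' ∈ Subgroup.zpowers ρH := (hρH z').2 ⟨i, hi⟩
    have hpair : IsDihedralPair ρH σ' := isDihedralPair_of_reflection heH hρH hj
    have hc' : Commute z' σ' := hpair.commute hz'ρ hzz'
    have hzH {f} := bockstein_eq_zero_iff_commutatorPairing hpair hz'ρ hzz'
      (fun h => hz1 (congrArg Subtype.val h)) f
    have hres (f : circleCocycles G) :
        commutatorPairing z' σ' (circleCocycles.res H f) = commutatorPairing z σ f := rfl
    obtain ⟨f₀, hf₀⟩ := exists_commutatorPairing_ne_zero e.toMonoidHom hi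
      (by
        rintro rfl
        exact hz1 (heG (by rw [hi, map_one, DihedralGroup.one_def]))) hj
    have hf₀ne : bockstein H (circleCocycles.res H f₀) ≠ 0 := fun h => hf₀ ((hres f₀) ▸ hzH.1 h)
    -- The pairing takes values in the elements of order at most two of `ℚ/ℤ`, so two classes on
    -- which it is nonzero agree.
    have huniq (y : integralCohomology H 3) (hy : y ≠ 0) :
        y = bockstein H (circleCocycles.res H f₀) := by
      obtain ⟨f, rfl⟩ := bockstein_surjective H y
      rw [← sub_eq_zero, ← map_sub, hzH, commutatorPairing_sub, sub_eq_zero]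
      exact AddCircle.eq_of_two_nsmul_eq_zero (two_nsmul_commutatorPairing hc' hzz' _)
        (two_nsmul_commutatorPairing hc' hzz' _) (fun h => hy (hzH.2 h)) hf₀
    have hbij : Function.Bijective (integralRes H 3).hom := by
      refine ⟨(injective_iff_map_eq_zero _).2 fun x hx => ?_, fun y => ?_⟩
      · obtain ⟨f, rfl⟩ := bockstein_surjective G x
        rw [integralRes_bockstein, hzH, hres] at hx
        exact hzG.2 hx
      · by_cases hy : y = 0
        · exact ⟨0, by rw [map_zero, hy]⟩
        · exact ⟨bockstein G f₀, by rw [integralRes_bockstein, huniq y hy]⟩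
    have hcard : Nat.card (integralCohomology H 3) = 2 :=
      (Nat.card_eq_two_iff' 0).2 ⟨_, hf₀ne, huniq⟩
    let eH : integralCohomology H 3 ≃+ ZMod 2 :=
      (zmodAddCyclicAddEquiv (isAddCyclic_of_prime_card hcard)).symm.trans
        (ZMod.ringEquivCongr hcard).toAddEquiv
    exact ⟨hbij, (AddEquiv.ofBijective (integralRes H 3).hom hbij).trans eH, eH, fun _ => rfl⟩
  · ext x
    have hzero (y : integralCohomology H 3) : y = 0 := by
      by_cases hσ : ∃ (σ : H) (j : ZMod n), e σ = DihedralGroup.sr j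
      · obtain ⟨σ, j, hj⟩ := hσ
        have hpair := isDihedralPair_of_reflection heH hρH hj
        refine integralCohomology_three_eq_zero_of_isDihedralPair hpair (fun z hz hzz => ?_) y
        by_contra hz1
        have hσ1 : σ ≠ 1 := fun h => hpair.notMem (h ▸ one_mem _)
        have hzσ : z ≠ σ := fun h => hpair.notMem (h ▸ hz)
        exact hK (exists_isKleinFour_le z.2 σ.2 (by simpa using hz1) (by simpa using hσ1)
          (fun h => hzσ (Subtype.ext h)) (congrArg Subtype.val hzz)
          (congrArg Subtype.val hpair.sq) (congrArg Subtype.val (hpair.commute hz hzz).eq))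
      · refine integralCohomology_three_eq_zero_of_isCyclic (ρ := ρH) (fun g => (hρH g).2 ?_) y
        rcases hg : e g with i | i
        · exact ⟨i, hg⟩
        · exact absurd ⟨g, i, hg⟩ hσ
    rw [hzero ((integralRes H 3).hom x)]
    rfl
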